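/- Consider the CONGEST model with bandwidth constant $\beta>0$: the nodes of an undirected connected graph $G$ on $n$ nodes have unique ids in $\{1,\dots,n\}$; initially each node knows $n$, its own id, the ids of its neighbors and its random seed (the seeds of the nodes may be independent or arbitrarily correlated; a deterministic algorithm is the special case of constant seeds); computation proceeds in synchronous rounds, in each of which every node may send to each of its neighbors a (possibly different) message of at most $\beta\log n$ bits, and local computation is free. A randomized algorithm computes a graph parameter $f$ in $T$ rounds on a class of $n$-node networks if, for every network $G$ in the class, with probability at least $2/3$ all nodes output $f(G)$ after $T$ rounds. Theorem. There are absolute constants $C$ and $\Delta$ such that for every $\beta>0$ there are $c>0$ and $N$ for which the following holds for all $n\ge N$. Let $\mathcal G_n$ be the class of connected $n$-node graphs with at most $C\,n\log n$ edges and diameter at most $\Delta$. 1. Every randomized CONGEST algorithm (with messages of at most $\beta \log n$ bits) that computes the diameter on $\mathcal G_n$ in $T$ rounds has $T\ge c\,n/\log^2 n$. 2. Every such algorithm that decides on $\mathcal G_n$ whether the diameter is at least $5$ in $T$ rounds has $T\ge c\,n/\log^2 n$. That is, computing the diameter of a sparse network of constant diameter, and even deciding whether it is at least $5$, takes $\Omega(n/\log^2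 n)$ rounds in the CONGEST model, even for randomized algorithms. -/

import Mathlib

namespace Congest

/-- A message of at most `B` bits. The empty string plays the role of sending nothing. -/
abbrev Message (B : ℕ) : Type := {m : List Bool // m.length ≤ B}

/-- The program run by the nodes of an `n`-node network in the CONGEST model with messages of at
most `B` bits; `R` is the type of the random seed of a node and `α` the type of the outputs.
The nodes are identified with their unique ids, the elements of `Fin n`. -/
structure Program (n B : ℕ) (R α : Type) where
  /-- The local states of a node. There is no bound on local memory or computation. -/
  State : Type
  /-- The initial state of a node is a function of its id, the ids of its neighbors and its
  random seed, and of nothing else. -/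
  init : Fin n → Set (Fin n) → R → State
  /-- The message that a node in a given state sends in this round to the neighbor with the given
  id. Different neighbors may get different messages. -/
  send : State → Fin n → Message B
  /-- The new state of a node, from its state and the messages received in this round: the value
  at `w` is the message from `w`, or `none` if `w` is not a neighbor. -/
  receive : State → (Fin n → Option (Message B)) → State
  /-- The output of a node in a given state. -/
  output : State → α

open Classical in
/-- The state of each node after `t` synchronous rounds on the network `G` with seeds `r`. -/
noncomputable def Program.stateAfter {n B : ℕ} {R α : Type} (P : Program n B R α)
    (G : SimpleGraph (Fin n)) (r : Fin n → R) : ℕ → Fin n → P.State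
  | 0, v => P.init v (G.neighborSet v) (r v)
  | t + 1, v => P.receive (P.stateAfter G r t v) fun w =>
      if G.Adj w v then some (P.send (P.stateAfter G r t w) v) else none

/-- A randomized CONGEST algorithm for `n`-node networks. The seeds of the nodes have an arbitrary
joint law: the product of the laws of the single seeds gives independent private randomness, a law
on the diagonal gives shared randomness, and a one-point seed type gives deterministic
algorithms. -/
structure RandomizedAlgorithm (n B : ℕ) (α : Type) where
  /-- The random seeds of a node. -/
  Seed : Type
  /-- The events of the seed space. -/
  seedEvents : MeasurableSpace Seed
  /-- The joint law of the seeds of all nodes. -/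
  law : MeasureTheory.Measure (Fin n → Seed)
  /-- The law is a probability measure. -/
  isProbability : MeasureTheory.IsProbabilityMeasure law
  /-- The program that every node runs. -/
  program : Program n B Seed α

/-- The event that after `T` rounds on the network `G` every node outputs `a`. -/
def RandomizedAlgorithm.allOutput {n B : ℕ} {α : Type} (A : RandomizedAlgorithm n B α)
    (G : SimpleGraph (Fin n)) (T : ℕ) (a : α) : Set (Fin n → A.Seed) :=
  {r | ∀ v, A.program.output (A.program.stateAfter G r T v) = a}

/-- `A` computes the graph parameter `f` within `T` rounds on every network of the class `𝒢`:
for each network in `𝒢`, after `T` rounds all nodes know the value of `f`, with probability at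
least `2 / 3`. -/
def RandomizedAlgorithm.Computes {n B : ℕ} {α : Type} (A : RandomizedAlgorithm n B α) (T : ℕ)
    (𝒢 : Set (SimpleGraph (Fin n))) (f : SimpleGraph (Fin n) → α) : Prop :=
  letI := A.seedEvents
  ∀ G ∈ 𝒢, MeasurableSet (A.allOutput G T (f G)) ∧ 2 / 3 ≤ A.law (A.allOutput G T (f G))

/-- The connected `n`-node networks with at most `C n log n` edges and diameter at most `Δ`. -/
def sparseNetworks (n : ℕ) (C : ℝ) (Δ : ℕ) : Set (SimpleGraph (Fin n)) :=
  {G | G.Connected ∧ (G.edgeSet.ncard : ℝ) ≤ C * (n * Real.log n) ∧ G.diam ≤ Δ}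

end Congest

namespace Congest

open Finset

/-! ### The level-one inequality for subsets of the cube -/

/-! Set disjointness on `2 ^ L` coordinates, with `2 ^ L` linear in `n`, reduces to the diameter
question. In `Node.network` the leaf `i` of either side sees the bit vertices that spell `i`, each
bit vertex is joined to the opposite bit on the other side, and a leaf is joined to its own hub
exactly when its input is `false`. Leaves with different indices on opposite sides are within
distance 3 through a differing bit, so distance 5 occurs only between two leaves of the same index
whose inputs are both `true` (`Node.five_le_diam_network_iff`). Only `O(L)` edges cross between the
sides, so `T` rounds communicate `O(T L B)` bits. The transcript together with one node's answer is
a rectangular map (`isRectangular_answeredTranscript`), and averaging fixes the seeds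
(`exists_mem_many`).

Disjointness is bounded below in `card_le_log_card_of_advantage`. A mask `d` assigns every
coordinate to one player, who gets a uniform bit there, so the inputs are disjoint. By the level-one
inequality `sum_sq_bias_le`, a map with few values barely depends, in Hellinger distance, on an
average bit (`sum_hellinger_le`). Hence writing `(1,0)` or `(0,1)` into a typical coordinate gives
nearly the same law as `(0,0)`. Cut and paste (`hellinger_law_cut_paste`) transfers this to `(0,0)`
against `(1,1)`, which a correct algorithm must distinguish. -/

/-- The sign `±1` of a bit. -/
def bitSign (b : Bool) : ℝ := if b then 1 else -1

section Cube

variable {κ : Type*} [Fintype κ] [DecidableEq κ]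

/-- The number of points of `S` with `z i = true` minus the number of those with `z i = false`. -/
noncomputable def bias (S : Finset (κ → Bool)) (i : κ) : ℝ := ∑ z ∈ S, bitSign (z i)

/-- The exponential factors over coordinates, and `cosh t ≤ exp (t ^ 2 / 2)`. -/
theorem sum_exp_signs_le (a : κ → ℝ) :
    ∑ z : κ → Bool, Real.exp (∑ i, a i * bitSign (z i)) ≤
      2 ^ Fintype.card κ * Real.exp ((∑ i, a i ^ 2) / 2) := by
  have h : ∑ z : κ → Bool, Real.exp (∑ i, a i * bitSign (z i)) = ∏ i, (2 * Real.cosh (a i)) := by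
    have := Finset.prod_univ_sum (fun _ : κ => (univ : Finset Bool))
      (fun i b => Real.exp (a i * bitSign b))
    rw [Fintype.piFinset_univ] at this
    simp_rw [Real.exp_sum]
    rw [← this]
    refine prod_congr rfl fun i _ => ?_
    rw [Real.cosh_eq]
    simp [bitSign]
    ring
  rw [h, prod_mul_distrib, prod_const, card_univ, sum_div, Real.exp_sum]
  gcongr with i
  exact Real.cosh_le_exp_half_sq _

/-- Let `a` be the mean sign vector of `S` and `A` its squared norm. The linear form with
coefficients `a` has mean `A` on `S`, so Jensen gives `exp A` at most the average of its exponential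
over `S`. Enlarging that sum to the whole cube bounds it by `exp (A / 2)` times the inverse density
of `S`. -/
theorem sum_sq_bias_le {S : Finset (κ → Bool)} (hS : S.Nonempty) :
    ∑ i, bias S i ^ 2 ≤ 2 * (#S : ℝ) ^ 2 * Real.log (2 ^ Fintype.card κ / #S) := by
  have hc : (0 : ℝ) < #S := by exact_mod_cast hS.card_pos
  set a : κ → ℝ := fun i => bias S i / #S with ha
  set A := ∑ i, a i ^ 2 with hA
  have hmean : ∑ z ∈ S, (1 / (#S : ℝ)) • (∑ i, a i * bitSign (z i)) = A := by
    rw [← smul_sum, sum_comm, hA, smul_eq_mul, mul_sum]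
    refine sum_congr rfl fun i _ => ?_
    rw [← mul_sum]
    simp only [ha, bias]
    ring
  have hJ := convexOn_exp.map_sum_le (t := S) (w := fun _ => 1 / (#S : ℝ))
    (p := fun z => ∑ i, a i * bitSign (z i)) (fun _ _ => by positivity)
    (by rw [sum_const, nsmul_eq_mul]; field_simp) (fun _ _ => Set.mem_univ _)
  rw [hmean, ← smul_sum, smul_eq_mul] at hJ
  have hsub : ∑ z ∈ S, Real.exp (∑ i, a i * bitSign (z i)) ≤
      2 ^ Fintype.card κ * Real.exp (A / 2) :=
    (sum_le_univ_sum_of_nonneg fun _ => (Real.exp_pos _).le).trans (sum_exp_signs_le a)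
  have h1 : Real.exp A ≤ (2 ^ Fintype.card κ / #S) * Real.exp (A / 2) :=
    calc Real.exp A ≤ 1 / #S * (2 ^ Fintype.card κ * Real.exp (A / 2)) := hJ.trans (by gcongr)
      _ = _ := by ring
  have h2 : A / 2 ≤ Real.log (2 ^ Fintype.card κ / #S) := by
    rw [Real.le_log_iff_exp_le (by positivity)]
    have : Real.exp A = Real.exp (A / 2) * Real.exp (A / 2) := by
      rw [← Real.exp_add]; ring_nf
    rw [this] at h1
    exact le_of_mul_le_mul_right h1 (Real.exp_pos _)
  have h3 : ∑ i, bias S i ^ 2 = (#S : ℝ) ^ 2 * A := by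
    rw [hA, mul_sum]
    refine sum_congr rfl fun i _ => ?_
    simp only [ha]
    field_simp
  rw [h3]
  nlinarith [sq_nonneg (#S : ℝ)]

/-- Flipping one bit, as a permutation of the cube. -/
def flipBit (i : κ) : Equiv.Perm (κ → Bool) :=
  Function.Involutive.toPerm (fun z => Function.update z i (!z i)) fun z => by simp

/-- How many points of the cube enter `S` when bit `i` is set to `b`. -/
noncomputable def hits (S : Finset (κ → Bool)) (i : κ) (b : Bool) : ℝ :=
  ∑ z : κ → Bool, if Function.update z i b ∈ S then 1 else 0

theorem hits_nonneg (S : Finset (κ → Bool)) (i : κ) (b : Bool) : 0 ≤ hits S i b :=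
  sum_nonneg fun _ _ => by split_ifs <;> norm_num

theorem sum_flipBit (i : κ) (F : (κ → Bool) → ℝ) :
    ∑ z, F (Function.update z i (!z i)) = ∑ z, F z :=
  Equiv.sum_comp (flipBit i) F

/-- Setting bit `i` both ways yields `z` and its flip in some order, so summing over `z` meets each
point of `S` twice. -/
theorem hits_add_hits (S : Finset (κ → Bool)) (i : κ) :
    hits S i true + hits S i false = 2 * #S := by
  have h : hits S i true + hits S i false =
      ∑ z : κ → Bool, ((if z ∈ S then 1 else 0) +
        if Function.update z i (!z i) ∈ S then 1 else 0) := by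
    rw [hits, hits, ← sum_add_distrib]
    refine sum_congr rfl fun z _ => ?_
    have hz : Function.update z i (z i) = z := Function.update_eq_self i z
    rcases h : z i <;> rw [h] at hz <;> simp [hz, add_comm]
  rw [h, sum_add_distrib, sum_flipBit i fun z => if z ∈ S then (1 : ℝ) else 0]
  simp [two_mul]

theorem hits_sub_hits (S : Finset (κ → Bool)) (i : κ) :
    hits S i true - hits S i false = 2 * bias S i := by
  have h : hits S i true - hits S i false =
      ∑ z : κ → Bool, ((if z ∈ S then bitSign (z i) else 0) +
        if Function.update z i (!z i) ∈ S then
          bitSign (Function.update z i (!z i) i) else 0) := by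
    rw [hits, hits, ← sum_sub_distrib]
    refine sum_congr rfl fun z _ => ?_
    have hz : Function.update z i (z i) = z := Function.update_eq_self i z
    rcases h : z i <;> rw [h] at hz <;> simp [hz, bitSign] <;> split_ifs <;> norm_num
  rw [h, sum_add_distrib, sum_flipBit i fun z => if z ∈ S then bitSign (z i) else 0]
  simp [bias, two_mul]

theorem sq_sqrt_sub_sqrt_mul_le {p q : ℝ} (hp : 0 ≤ p) (hq : 0 ≤ q) :
    (√p - √q) ^ 2 * (p + q) ≤ (p - q) ^ 2 := by
  have h1 := Real.sq_sqrt hp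
  have h2 := Real.sq_sqrt hq
  have h3 : (p - q) ^ 2 = (√p - √q) ^ 2 * (√p + √q) ^ 2 := by
    nth_rw 1 [← h1, ← h2]; ring
  rw [h3]
  gcongr
  nlinarith [mul_nonneg (Real.sqrt_nonneg p) (Real.sqrt_nonneg q)]

theorem sum_sq_sqrt_hits_le (S : Finset (κ → Bool)) :
    ∑ i, (√(hits S i true) - √(hits S i false)) ^ 2 ≤
      4 * #S * Real.log (2 ^ Fintype.card κ / #S) := by
  rcases S.eq_empty_or_nonempty with rfl | hS
  · simp [hits]
  have hc : (0 : ℝ) < #S := by exact_mod_cast hS.card_pos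
  have h : ∀ i, (√(hits S i true) - √(hits S i false)) ^ 2 ≤ 2 / #S * bias S i ^ 2 := fun i => by
    have := sq_sqrt_sub_sqrt_mul_le (hits_nonneg S i true) (hits_nonneg S i false)
    rw [hits_add_hits, hits_sub_hits] at this
    rw [div_mul_eq_mul_div, le_div_iff₀ hc]
    linarith
  calc _ ≤ ∑ i, 2 / #S * bias S i ^ 2 := sum_le_sum fun i _ => h i
    _ = 2 / #S * ∑ i, bias S i ^ 2 := by rw [mul_sum]
    _ ≤ 2 / #S * (2 * (#S : ℝ) ^ 2 * Real.log (2 ^ Fintype.card κ / #S)) := by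
        gcongr; exact sum_sq_bias_le hS
    _ = _ := by field_simp; ring

variable {M : Type*} [Fintype M] [DecidableEq M]

/-- This is the bound `log |M|` for the entropy of `g` at a uniform point, from `log t ≤ t - 1` in
each fiber. -/
theorem sum_card_mul_log_le (g : (κ → Bool) → M) :
    ∑ m, (#{z | g z = m} : ℝ) * Real.log (2 ^ Fintype.card κ / #{z | g z = m}) ≤
      2 ^ Fintype.card κ * Real.log (Fintype.card M) := by
  have : Nonempty M := ⟨g fun _ => true⟩
  have hM : (0 : ℝ) < Fintype.card M := by exact_mod_cast Fintype.card_pos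
  have hsum : ∑ m, (#{z | g z = m} : ℝ) = 2 ^ Fintype.card κ := by
    rw [← Nat.cast_sum, ← card_eq_sum_card_fiberwise (fun _ _ => by simp)]
    simp
  have h : ∀ m, (#{z | g z = m} : ℝ) * Real.log (2 ^ Fintype.card κ / #{z | g z = m}) ≤
      #{z | g z = m} * Real.log (Fintype.card M) +
        (2 ^ Fintype.card κ / Fintype.card M - #{z | g z = m}) := fun m => by
    rcases Nat.eq_zero_or_pos #{z | g z = m} with h0 | h0
    · rw [h0]; simp; positivity
    set c : ℝ := (#{z | g z = m} : ℝ) with hc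
    have hc0 : 0 < c := by rw [hc]; exact_mod_cast h0
    have h1 := Real.log_le_sub_one_of_pos (x := 2 ^ Fintype.card κ / c / Fintype.card M)
      (by positivity)
    rw [Real.log_div (by positivity) hM.ne'] at h1
    have h2 := mul_le_mul_of_nonneg_left h1 hc0.le
    have h3 : c * (2 ^ Fintype.card κ / c / Fintype.card M - 1) =
      2 ^ Fintype.card κ / Fintype.card M - c := by field_simp
    linarith
  refine (sum_le_sum fun m _ => h m).trans ?_
  rw [sum_add_distrib, sum_sub_distrib, ← sum_mul, hsum, sum_const, nsmul_eq_mul, card_univ]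
  field_simp
  simp

/-- A map from the cube to a small set has small total Hellinger influence. -/
theorem sum_hellinger_le (g : (κ → Bool) → M) :
    ∑ i, ∑ m, (√(#{z | g (Function.update z i true) = m} : ℝ) -
        √(#{z | g (Function.update z i false) = m} : ℝ)) ^ 2 ≤
      4 * 2 ^ Fintype.card κ * Real.log (Fintype.card M) := by
  have h : ∀ m i b, (#{z | g (Function.update z i b) = m} : ℝ) = hits {z | g z = m} i b := by
    intro m i b; simp [hits]
  simp_rw [h]
  rw [sum_comm]
  refine (sum_le_sum fun m _ => sum_sq_sqrt_hits_le _).trans ?_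
  have := sum_card_mul_log_le g
  simp_rw [mul_assoc, ← mul_sum]
  linarith

end Cube

set_option linter.unusedSectionVars false

/-! ### The randomized communication complexity of disjointness -/

section Disjointness

variable {ι M : Type*} [Fintype ι] [DecidableEq ι] [Fintype M] [DecidableEq M]

/-- The squared distance between the square roots of two functions. -/
noncomputable def hellinger (p q : M → ℝ) : ℝ := ∑ m, (√(p m) - √(q m)) ^ 2

theorem hellinger_triangle (p q r : M → ℝ) :
    hellinger p r ≤ 2 * (hellinger q p + hellinger q r) := by
  simp only [hellinger]
  rw [← sum_add_distrib, mul_sum]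
  refine sum_le_sum fun m _ => ?_
  nlinarith [sq_nonneg (√(q m) - √(p m) + (√(q m) - √(r m)))]

theorem hellinger_eq {p q : M → ℝ} (hp : ∀ m, 0 ≤ p m) (hq : ∀ m, 0 ≤ q m) :
    hellinger p q = ∑ m, p m + ∑ m, q m - 2 * ∑ m, √(p m * q m) := by
  rw [hellinger, ← sum_add_distrib, mul_sum, ← sum_sub_distrib]
  refine sum_congr rfl fun m _ => ?_
  rw [sub_sq, Real.sq_sqrt (hp m), Real.sq_sqrt (hq m), Real.sqrt_mul (hp m)]
  ring

/-- A quantitative comparison of total variation and Hellinger distance. -/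
theorem sum_sub_le_hellinger {p q : M → ℝ} (hp : ∀ m, 0 ≤ p m) (hq : ∀ m, 0 ≤ q m)
    (E : Finset M) {s : ℝ} (hs : 0 < s) :
    ∑ m ∈ E, (p m - q m) ≤ s / 2 * hellinger q p + (∑ m, p m + ∑ m, q m) / s := by
  have h : ∀ m, |p m - q m| ≤ s / 2 * (√(q m) - √(p m)) ^ 2 + (p m + q m) / s := fun m => by
    have h1 := Real.sq_sqrt (hp m)
    have h2 := Real.sq_sqrt (hq m)
    have h3 : |p m - q m| = |√(q m) - √(p m)| * (√(p m) + √(q m)) := by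
      rw [← abs_of_nonneg (add_nonneg (Real.sqrt_nonneg (p m)) (Real.sqrt_nonneg (q m))),
        ← abs_mul, ← abs_neg]
      congr 1
      nlinarith
    rw [h3, ← sq_abs (√(q m) - √(p m))]
    rw [show p m + q m = √(p m) ^ 2 + √(q m) ^ 2 by rw [h1, h2]]
    -- AM-GM, with `s` balancing the two factors.
    have h4 : |√(q m) - √(p m)| * (√(p m) + √(q m)) ≤
        s / 2 * |√(q m) - √(p m)| ^ 2 + (√(p m) + √(q m)) ^ 2 / (2 * s) := by
      have : s / 2 * |√(q m) - √(p m)| ^ 2 + (√(p m) + √(q m)) ^ 2 / (2 * s) -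
          |√(q m) - √(p m)| * (√(p m) + √(q m)) =
          (s * |√(q m) - √(p m)| - (√(p m) + √(q m))) ^ 2 / (2 * s) := by
        field_simp; ring
      have h5 : 0 ≤ (s * |√(q m) - √(p m)| - (√(p m) + √(q m))) ^ 2 / (2 * s) := by positivity
      linarith
    have h6 : (√(p m) + √(q m)) ^ 2 / (2 * s) ≤ (√(p m) ^ 2 + √(q m) ^ 2) / s := by
      rw [div_le_div_iff₀ (by positivity) hs]
      nlinarith [mul_nonneg hs.le (sq_nonneg (√(p m) - √(q m)))]
    linarith
  calc ∑ m ∈ E, (p m - q m) ≤ ∑ m ∈ E, |p m - q m| := sum_le_sum fun m _ => le_abs_self _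
    _ ≤ ∑ m, |p m - q m| := sum_le_univ_sum_of_nonneg fun m => abs_nonneg _
    _ ≤ ∑ m, (s / 2 * (√(q m) - √(p m)) ^ 2 + (p m + q m) / s) := sum_le_sum fun m _ => h m
    _ = _ := by rw [sum_add_distrib, ← mul_sum, ← sum_div, sum_add_distrib, hellinger]

/-- A map on pairs of inputs whose fibers are combinatorial rectangles. -/
def IsRectangular {X Y M : Type*} (Φ : X → Y → M) : Prop :=
  ∀ x y x' y', Φ x y = Φ x' y' → Φ x y' = Φ x y

/-- The set `z` outside `d`, with the membership of `i` overwritten by `u`. -/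
def leftInput (d z : ι → Bool) (i : ι) (u : Bool) : ι → Bool :=
  Function.update (fun j => z j && !d j) i u

/-- The set `z` inside `d`, with the membership of `i` overwritten by `u`. -/
def rightInput (d z : ι → Bool) (i : ι) (u : Bool) : ι → Bool :=
  Function.update (fun j => z j && d j) i u

theorem leftInput_update (d z : ι → Bool) (i : ι) (u b : Bool) :
    leftInput (Function.update d i b) z i u = leftInput d z i u := by
  ext j
  by_cases h : j = i
  · subst h; simp [leftInput]
  · simp [leftInput, h]

theorem rightInput_update (d z : ι → Bool) (i : ι) (u b : Bool) :
    rightInput (Function.update d i b) z i u = rightInput d z i u := by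
  ext j
  by_cases h : j = i
  · subst h; simp [rightInput]
  · simp [rightInput, h]

variable (Φ : (ι → Bool) → (ι → Bool) → M)

/-- The number of pairs of sets for which `Φ` takes the value `m` once `u` and `v` are written
into coordinate `i`. -/
noncomputable def law (d : ι → Bool) (i : ι) (u v : Bool) (m : M) : ℝ :=
  #{w : (ι → Bool) × (ι → Bool) | Φ (leftInput d w.1 i u) (rightInput d w.2 i v) = m}

theorem law_nonneg (d : ι → Bool) (i : ι) (u v : Bool) (m : M) : 0 ≤ law Φ d i u v m :=
  Nat.cast_nonneg _

/-- Coordinate `i` is overwritten for both players, so its owner is irrelevant; this lets `d i` be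
averaged out below. -/
theorem law_update (d : ι → Bool) (i : ι) (u v b : Bool) :
    law Φ (Function.update d i b) i u v = law Φ d i u v := by
  ext m
  simp only [law, leftInput_update, rightInput_update]

theorem sum_law (d : ι → Bool) (i : ι) (u v : Bool) :
    ∑ m, law Φ d i u v m = 4 ^ Fintype.card ι := by
  simp only [law]
  rw [← Nat.cast_sum, ← card_eq_sum_card_fiberwise (fun _ _ => by simp)]
  rw [card_univ, Fintype.card_prod, Fintype.card_fun, Fintype.card_bool]
  push_cast
  rw [← mul_pow]
  norm_num

variable {Φ}

open Classical in
theorem law_eq_mul (hΦ : IsRectangular Φ) (d : ι → Bool) (i : ι) (u v : Bool) (m : M) :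
    law Φ d i u v m = (#{z | ∃ y, Φ (leftInput d z i u) y = m} : ℝ) *
      #{z | ∃ x, Φ x (rightInput d z i v) = m} := by
  rw [law, ← Nat.cast_mul, ← card_product, ← filter_product]
  congr 2
  ext w
  simp only [mem_filter, mem_univ, true_and, mem_product]
  refine ⟨fun h => ⟨⟨_, h⟩, ⟨_, h⟩⟩, ?_⟩
  rintro ⟨⟨y, hy⟩, ⟨x, hx⟩⟩
  rw [hΦ _ y x _ (hy.trans hx.symm), hy]

/-- By `law_eq_mul` each law is a factor depending on `u` times one depending on `v`, so the
products for `(0,0), (1,1)` and for `(1,0), (0,1)` agree pointwise. With equal total masses,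
`hellinger_eq` depends only on these products. -/
theorem hellinger_law_cut_paste (hΦ : IsRectangular Φ) (d : ι → Bool) (i : ι) :
    hellinger (law Φ d i false false) (law Φ d i true true) =
      hellinger (law Φ d i true false) (law Φ d i false true) := by
  rw [hellinger_eq (law_nonneg Φ d i _ _) (law_nonneg Φ d i _ _),
    hellinger_eq (law_nonneg Φ d i _ _) (law_nonneg Φ d i _ _)]
  simp only [sum_law]
  congr 2
  refine sum_congr rfl fun m _ => ?_
  simp only [law_eq_mul hΦ]
  congr 1
  ring

variable (Φ)

theorem card_sum_arrow_eq_law (d : ι → Bool) (i : ι) (b : Bool) (m : M) :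
    (#{w : ι ⊕ ι → Bool | Φ (fun j => Function.update w (if d i then .inr i else .inl i) b
        (.inl j) && !d j) (fun j => Function.update w (if d i then .inr i else .inl i) b
        (.inr j) && d j) = m} : ℝ) =
      law Φ d i (!d i && b) (d i && b) m := by
  rw [law]
  congr 1
  refine card_equiv (Equiv.sumArrowEquivProdArrow ι ι Bool) fun w => ?_
  simp only [mem_filter, mem_univ, true_and]
  have h1 : (fun j => Function.update w (if d i then .inr i else .inl i) b (.inl j) && !d j) =
      leftInput d (Equiv.sumArrowEquivProdArrow ι ι Bool w).1 i (!d i && b) := by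
    ext j
    by_cases h : j = i
    · subst h; cases d j <;> simp [leftInput]
    · cases hd : d i <;> simp [leftInput, h, Equiv.sumArrowEquivProdArrow]
  have h2 : (fun j => Function.update w (if d i then .inr i else .inl i) b (.inr j) && d j) =
      rightInput d (Equiv.sumArrowEquivProdArrow ι ι Bool w).2 i (d i && b) := by
    ext j
    by_cases h : j = i
    · subst h; cases d j <;> simp [rightInput]
    · cases hd : d i <;> simp [rightInput, h, Equiv.sumArrowEquivProdArrow]
  rw [h1, h2]

/-- For fixed `d`, both inputs are functions of one point of the cube over `ι ⊕ ι`, to which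
`sum_hellinger_le` applies. Of the two bits over `i`, the one visible under `d` is kept and the
other's nonnegative term is dropped. -/
theorem sum_hellinger_law_le (d : ι → Bool) :
    ∑ i, hellinger (law Φ d i false false) (law Φ d i (!d i) (d i)) ≤
      4 * 4 ^ Fintype.card ι * Real.log (Fintype.card M) := by
  have h := sum_hellinger_le (κ := ι ⊕ ι) fun w =>
    Φ (fun j => w (.inl j) && !d j) (fun j => w (.inr j) && d j)
  have hc : (2 : ℝ) ^ Fintype.card (ι ⊕ ι) = 4 ^ Fintype.card ι := by
    rw [Fintype.card_sum, ← two_mul, pow_mul]; norm_num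
  rw [hc, Fintype.sum_sum_type, ← sum_add_distrib] at h
  refine le_trans (sum_le_sum fun i _ => ?_) h
  have ht := card_sum_arrow_eq_law Φ d i true
  have hf := card_sum_arrow_eq_law Φ d i false
  simp only [Bool.and_true, Bool.and_false] at ht hf
  simp only [hellinger, ← ht, ← hf]
  simp_rw [sub_sq_comm √(#{w : ι ⊕ ι → Bool |
    Φ (fun j => Function.update w _ false _ && _) _ = _} : ℝ)]
  cases d i
  · exact le_add_of_nonneg_right (sum_nonneg fun _ _ => sq_nonneg _)
  · exact le_add_of_nonneg_left (sum_nonneg fun _ _ => sq_nonneg _)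

theorem sum_hellinger_law_add_le :
    ∑ d, ∑ i, (hellinger (law Φ d i false false) (law Φ d i true false) +
        hellinger (law Φ d i false false) (law Φ d i false true)) ≤
      8 * 8 ^ Fintype.card ι * Real.log (Fintype.card M) := by
  have h := sum_le_sum fun (d : ι → Bool) (_ : d ∈ univ) => sum_hellinger_law_le Φ d
  have hc : (2 : ℝ) ^ Fintype.card ι * 4 ^ Fintype.card ι = 8 ^ Fintype.card ι := by
    rw [← mul_pow]; norm_num
  rw [sum_const, card_univ, Fintype.card_fun, Fintype.card_bool, nsmul_eq_mul, sum_comm] at h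
  push_cast at h
  have h' : ∑ i, ∑ d, (hellinger (law Φ d i false false) (law Φ d i true false) +
        hellinger (law Φ d i false false) (law Φ d i false true)) =
      2 * ∑ i, ∑ d, hellinger (law Φ d i false false) (law Φ d i (!d i) (d i)) := by
    rw [mul_sum]
    refine sum_congr rfl fun i _ => ?_
    rw [two_mul]
    -- Flipping `d i` in one of the two copies turns its single-bit deviation into the other
    -- player's, while `law_update` keeps the laws fixed.
    conv_rhs => lhs; rw [← sum_flipBit i]
    rw [← sum_add_distrib]
    refine sum_congr rfl fun d _ => ?_
    simp only [law_update, Function.update_self]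
    cases d i
    · simp only [Bool.not_false, Bool.not_true, add_comm]
    · simp only [Bool.not_false, Bool.not_true]
  rw [sum_comm, h']
  rw [← hc]
  linarith

variable {Φ}

/-- Disjointness lower bound: a rectangular map from which an event detects, with average
advantage `1 / 3`, whether the inputs meet in a planted coordinate has exponentially many
values. -/
theorem card_le_log_card_of_advantage (hΦ : IsRectangular Φ) (E : Finset M)
    (h : 1 / 3 * (Fintype.card ι * 8 ^ Fintype.card ι) ≤
      ∑ d : ι → Bool, ∑ i, ∑ w : (ι → Bool) × (ι → Bool),
        ((if Φ (leftInput d w.1 i true) (rightInput d w.2 i true) ∈ E then 1 else 0 : ℝ) -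
          if Φ (leftInput d w.1 i false) (rightInput d w.2 i false) ∈ E then 1 else 0)) :
    (Fintype.card ι : ℝ) ≤ 576 * Real.log (Fintype.card M) := by
  have hE : ∀ d i u, ∑ w : (ι → Bool) × (ι → Bool),
      (if Φ (leftInput d w.1 i u) (rightInput d w.2 i u) ∈ E then 1 else 0 : ℝ) =
      ∑ m ∈ E, law Φ d i u u m := fun d i u => by
    simp only [law]
    rw [← Nat.cast_sum, sum_card_fiberwise_eq_card_filter]
    simp
  have hc : (2 : ℝ) ^ Fintype.card ι * 4 ^ Fintype.card ι = 8 ^ Fintype.card ι := by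
    rw [← mul_pow]; norm_num
  have hb : ∀ d i, ∑ m ∈ E, (law Φ d i true true m - law Φ d i false false m) ≤
      12 * (hellinger (law Φ d i false false) (law Φ d i true false) +
        hellinger (law Φ d i false false) (law Φ d i false true)) +
        4 ^ Fintype.card ι / 6 := fun d i => by
    -- With `s = 12` the error term is `1 / 6` of the total mass, half of the assumed advantage.
    have h1 := sum_sub_le_hellinger (law_nonneg Φ d i true true) (law_nonneg Φ d i false false) E
      (s := 12) (by norm_num)
    rw [hellinger_law_cut_paste hΦ, sum_law, sum_law] at h1
    have h2 := hellinger_triangle (law Φ d i true false) (law Φ d i false false)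
      (law Φ d i false true)
    linarith
  simp only [sum_sub_distrib, hE] at h
  simp only [← sum_sub_distrib] at h
  have h3 := h.trans (sum_le_sum fun d _ => sum_le_sum fun i _ => hb d i)
  simp only [sum_add_distrib, ← mul_sum, sum_const, card_univ, Fintype.card_fun,
    Fintype.card_bool, nsmul_eq_mul] at h3
  have h4 := sum_hellinger_law_add_le Φ
  simp only [sum_add_distrib] at h4
  push_cast at h3
  have h8 : (0 : ℝ) < 8 ^ Fintype.card ι := by positivity
  have h5 : Fintype.card ι * ((2 : ℝ) ^ Fintype.card ι * (4 ^ Fintype.card ι / 6)) =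
      Fintype.card ι * 8 ^ Fintype.card ι / 6 := by rw [← hc]; ring
  refine le_of_mul_le_mul_right ?_ h8
  linarith

end Disjointness

/-! ### Simulation of a CONGEST algorithm by two players -/

/-- A family of networks indexed by the inputs of two players. The first player knows the edges at
the vertices of `left`, the second player those at the other vertices, and the edges between the
two parts are, in both directions, among the pairs `cut c`. -/
structure TwoPartyFamily (n : ℕ) (X Y C : Type*) where
  /-- The network for given inputs. -/
  graph : X → Y → SimpleGraph (Fin n)
  /-- The vertices of the first player. -/
  left : Set (Fin n)
  /-- The directed edges between the two parts. -/
  cut : C → Fin n × Fin n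
  adj_left : ∀ x y y' u v, u ∈ left → ((graph x y).Adj u v ↔ (graph x y').Adj u v)
  adj_right : ∀ x x' y u v, u ∉ left → ((graph x y).Adj u v ↔ (graph x' y).Adj u v)
  exists_cut : ∀ x y u v, (graph x y).Adj u v → (u ∈ left ↔ v ∉ left) → ∃ c, cut c = (u, v)

namespace TwoPartyFamily

variable {n B : ℕ} {X Y C : Type*} {R α : Type} (F : TwoPartyFamily n X Y C) (P : Program n B R α)
  (r : Fin n → R) (T : ℕ)

/-- The messages sent across the cut in the first `T` rounds. -/
noncomputable def transcript (x : X) (y : Y) : Fin T → C → Fin B → Option Bool := fun t c i =>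
  (P.send (P.stateAfter (F.graph x y) r t (F.cut c).1) (F.cut c).2).1[(i : ℕ)]?

/-- Reading `none` past the end also records the length, so `B` ternary symbols encode a message;
hence the `log 3` later. -/
theorem message_ext {m m' : Message B} (h : ∀ i : Fin B, m.1[(i : ℕ)]? = m'.1[(i : ℕ)]?) :
    m = m' := by
  refine Subtype.ext (List.ext_getElem? fun i => ?_)
  by_cases hi : i < B
  · exact h ⟨i, hi⟩
  · rw [List.getElem?_eq_none (m.2.trans (not_lt.1 hi)),
      List.getElem?_eq_none (m'.2.trans (not_lt.1 hi))]

variable {F P r T}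

theorem send_eq_of_transcript_eq {x x' : X} {y y' : Y}
    (h : F.transcript P r T x y = F.transcript P r T x' y') {t : ℕ} (ht : t < T) (c : C) :
    P.send (P.stateAfter (F.graph x y) r t (F.cut c).1) (F.cut c).2 =
      P.send (P.stateAfter (F.graph x' y') r t (F.cut c).1) (F.cut c).2 :=
  message_ext fun i => congrFun (congrFun (congrFun h ⟨t, ht⟩) c) i

/-- Induction on rounds: each part of the mixed network has the edges of its own original run, and
everything it receives across the cut is recorded in the common transcript. -/
theorem stateAfter_mixed {x x' : X} {y y' : Y}
    (h : F.transcript P r T x y = F.transcript P r T x' y') (t : ℕ) (ht : t ≤ T) :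
    (∀ u ∈ F.left, P.stateAfter (F.graph x y') r t u = P.stateAfter (F.graph x y) r t u) ∧
      ∀ u ∉ F.left, P.stateAfter (F.graph x y') r t u = P.stateAfter (F.graph x' y') r t u := by
  classical
  induction t with
  | zero =>
    refine ⟨fun u hu => ?_, fun u hu => ?_⟩
    · simp only [Program.stateAfter]
      congr 1
      ext v
      exact F.adj_left x y' y u v hu
    · simp only [Program.stateAfter]
      congr 1
      ext v
      exact F.adj_right x x' y' u v hu
  | succ t ih =>
    obtain ⟨ihl, ihr⟩ := ih (by omega)
    refine ⟨fun u hu => ?_, fun u hu => ?_⟩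
    · simp only [Program.stateAfter]
      rw [ihl u hu]
      congr 1
      ext1 w
      have hadj : (F.graph x y').Adj w u ↔ (F.graph x y).Adj w u := by
        rw [SimpleGraph.adj_comm, F.adj_left x y' y u w hu, SimpleGraph.adj_comm]
      by_cases hw : (F.graph x y).Adj w u
      · rw [if_pos hw, if_pos (hadj.2 hw)]
        by_cases hwl : w ∈ F.left
        · rw [ihl w hwl]
        · obtain ⟨c, hc⟩ := F.exists_cut x y w u hw (by simp [hwl, hu])
          have := send_eq_of_transcript_eq h (by omega : t < T) c
          rw [hc] at this
          rw [ihr w hwl, ← this]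
      · rw [if_neg hw, if_neg (hadj.not.2 hw)]
    · simp only [Program.stateAfter]
      rw [ihr u hu]
      congr 1
      ext1 w
      have hadj : (F.graph x y').Adj w u ↔ (F.graph x' y').Adj w u := by
        rw [SimpleGraph.adj_comm, F.adj_right x x' y' u w hu, SimpleGraph.adj_comm]
      by_cases hw : (F.graph x' y').Adj w u
      · rw [if_pos hw, if_pos (hadj.2 hw)]
        by_cases hwl : w ∈ F.left
        · obtain ⟨c, hc⟩ := F.exists_cut x' y' w u hw (by simp [hwl, hu])
          have := send_eq_of_transcript_eq h (by omega : t < T) c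
          rw [hc] at this
          rw [ihl w hwl, this]
        · rw [ihr w hwl]
      · rw [if_neg hw, if_neg (hadj.not.2 hw)]

theorem transcript_mixed {x x' : X} {y y' : Y}
    (h : F.transcript P r T x y = F.transcript P r T x' y') :
    F.transcript P r T x y' = F.transcript P r T x y := by
  funext t c i
  obtain ⟨hl, hr⟩ := stateAfter_mixed h t t.2.le
  by_cases hc : (F.cut c).1 ∈ F.left
  · simp only [transcript, hl _ hc]
  · rw [h]
    simp only [transcript, hr _ hc]

variable (F P r T)

open Classical in
/-- The transcript together with the answer to `q` read off the output of the vertex `v₀`. -/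
noncomputable def answeredTranscript (q : α → Prop) (v₀ : Fin n) (x : X) (y : Y) :
    (Fin T → C → Fin B → Option Bool) × Bool :=
  (F.transcript P r T x y, decide (q (P.output (P.stateAfter (F.graph x y) r T v₀))))

theorem isRectangular_answeredTranscript (q : α → Prop) {v₀ : Fin n} (hv₀ : v₀ ∈ F.left) :
    IsRectangular (F.answeredTranscript P r T q v₀) := by
  intro x y x' y' h
  have h1 : F.transcript P r T x y = F.transcript P r T x' y' := (Prod.ext_iff.1 h).1
  rw [answeredTranscript, answeredTranscript, transcript_mixed h1,
    (stateAfter_mixed h1 T le_rfl).1 v₀ hv₀]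

end TwoPartyFamily

/-- The easy direction of Yao's principle: some seed does at least as well as the mean number of
successes. Only the joint law enters, so correlated seeds are harmless. -/
theorem exists_mem_many {Ω S : Type*} [Fintype Ω] [MeasurableSpace S] (μ : MeasureTheory.Measure S)
    [MeasureTheory.IsProbabilityMeasure μ] (E : Ω → Set S) (hE : ∀ ω, MeasurableSet (E ω))
    (h : ∀ ω, 2 / 3 ≤ μ (E ω)) :
    ∃ r, 2 / 3 * (Fintype.card Ω : ℝ) ≤ ∑ ω, (E ω).indicator 1 r := by
  have hi : ∀ ω, MeasureTheory.Integrable ((E ω).indicator (1 : S → ℝ)) μ := fun ω =>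
    (MeasureTheory.integrable_const (1 : ℝ)).indicator (hE ω)
  obtain ⟨r, hr⟩ := MeasureTheory.exists_integral_le
    (MeasureTheory.integrable_finsetSum univ fun ω _ => hi ω) (μ := μ)
  refine ⟨r, le_trans ?_ hr⟩
  rw [MeasureTheory.integral_finsetSum _ fun ω _ => hi ω]
  have : ∀ ω, 2 / 3 ≤ ∫ s, (E ω).indicator (1 : S → ℝ) s ∂μ := fun ω => by
    rw [MeasureTheory.integral_indicator_one (hE ω), MeasureTheory.measureReal_def]
    have := ENNReal.toReal_mono (MeasureTheory.measure_ne_top μ _) (h ω)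
    simpa using this
  calc 2 / 3 * (Fintype.card Ω : ℝ) = ∑ _ω : Ω, (2 / 3 : ℝ) := by simp [mul_comm]
    _ ≤ _ := sum_le_sum fun ω _ => this ω

theorem not_leftInput_and_rightInput {ι : Type*} [DecidableEq ι] (d z z' : ι → Bool) (i j : ι) :
    ¬(leftInput d z i false j = true ∧ rightInput d z' i false j = true) := by
  by_cases h : j = i
  · subst h; simp [leftInput]
  · simp only [leftInput, rightInput, Function.update_of_ne h]
    cases d j <;> simp

/-- An algorithm that tells intersecting from disjoint inputs of a two-party family has to send
many bits across the cut. -/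
theorem TwoPartyFamily.card_le_of_computes {n B T : ℕ} {ι C : Type*} {α : Type} [Fintype ι]
    [DecidableEq ι] [Fintype C] [DecidableEq C]
    (F : TwoPartyFamily n (ι → Bool) (ι → Bool) C) (A : RandomizedAlgorithm n B α)
    {𝒢 : Set (SimpleGraph (Fin n))} {f : SimpleGraph (Fin n) → α} (hA : A.Computes T 𝒢 f)
    (hF : ∀ x y, F.graph x y ∈ 𝒢) (q : α → Prop)
    (hq : ∀ x y, q (f (F.graph x y)) ↔ ∃ i, x i = true ∧ y i = true)
    {v₀ : Fin n} (hv₀ : v₀ ∈ F.left) :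
    (Fintype.card ι : ℝ) ≤ 576 * (T * (Fintype.card C * (B * Real.log 3)) + Real.log 2) := by
  let _ := A.seedEvents
  have _ := A.isProbability
  let Ω := (ι → Bool) × ι × ((ι → Bool) × (ι → Bool))
  let G : Ω → Bool → SimpleGraph (Fin n) := fun ω u =>
    F.graph (leftInput ω.1 ω.2.2.1 ω.2.1 u) (rightInput ω.1 ω.2.2.2 ω.2.1 u)
  have hG : ∀ ω u, q (f (G ω u)) ↔ u = true := fun ω u => by
    rw [hq]
    cases u
    · simpa using not_leftInput_and_rightInput _ _ _ _
    · simpa using ⟨ω.2.1, by simp [leftInput], by simp [rightInput]⟩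
  obtain ⟨r, hr⟩ := exists_mem_many A.law
    (fun p : Ω × Bool => A.allOutput (G p.1 p.2) T (f (G p.1 p.2)))
    (fun p => (hA _ (hF _ _)).1) (fun p => (hA _ (hF _ _)).2)
  set Φ := F.answeredTranscript A.program r T q v₀ with hΦ
  classical
  -- Success rate `2 / 3` over the pairs `(ω, u)` makes the left side average at least `2 * (2 / 3)
  -- - 1 = 1 / 3`.
  have hadv : ∀ ω : Ω, (A.allOutput (G ω true) T (f (G ω true))).indicator 1 r +
      (A.allOutput (G ω false) T (f (G ω false))).indicator 1 r - 1 ≤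
      (if Φ (leftInput ω.1 ω.2.2.1 ω.2.1 true) (rightInput ω.1 ω.2.2.2 ω.2.1 true) ∈
          ({m | m.2 = true} : Finset _) then 1 else 0 : ℝ) -
        if Φ (leftInput ω.1 ω.2.2.1 ω.2.1 false) (rightInput ω.1 ω.2.2.2 ω.2.1 false) ∈
          ({m | m.2 = true} : Finset _) then 1 else 0 := fun ω => by
    have h : ∀ u, r ∈ A.allOutput (G ω u) T (f (G ω u)) →
        (Φ (leftInput ω.1 ω.2.2.1 ω.2.1 u) (rightInput ω.1 ω.2.2.2 ω.2.1 u) ∈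
          ({m | m.2 = true} : Finset _) ↔ u = true) := fun u hu => by
      rw [← hG ω u, ← hu v₀]
      simp [hΦ, answeredTranscript, G]
    have ht := h true
    have hf := h false
    simp only [Set.indicator_apply, Pi.one_apply]
    by_cases h1 : r ∈ A.allOutput (G ω true) T (f (G ω true)) <;>
    by_cases h2 : r ∈ A.allOutput (G ω false) T (f (G ω false))
    · rw [if_pos h1, if_pos h2, if_pos ((ht h1).2 rfl), if_neg ((hf h2).not.2 (by simp))]; norm_num
    · rw [if_pos h1, if_neg h2, if_pos ((ht h1).2 rfl)]; split_ifs <;> norm_num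
    · rw [if_neg h1, if_pos h2, if_neg ((hf h2).not.2 (by simp))]; split_ifs <;> norm_num
    · rw [if_neg h1, if_neg h2]; split_ifs <;> norm_num
  have hcard : (Fintype.card Ω : ℝ) = Fintype.card ι * 8 ^ Fintype.card ι := by
    simp only [Ω, Fintype.card_prod, Fintype.card_fun, Fintype.card_bool]
    push_cast
    rw [show (8 : ℝ) = 2 * (2 * 2) by norm_num, mul_pow, mul_pow]
    ring
  have hsum := sum_le_sum fun ω (_ : ω ∈ (univ : Finset Ω)) => hadv ω
  rw [Fintype.sum_prod_type_right, Fintype.card_prod, Fintype.card_bool, Fintype.sum_bool,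
    ← sum_add_distrib] at hr
  rw [sum_sub_distrib, sum_const, card_univ, nsmul_eq_mul, mul_one] at hsum
  have h := card_le_log_card_of_advantage
    (F.isRectangular_answeredTranscript A.program r T q hv₀) {m | m.2 = true} (by
      rw [← hcard]
      push_cast at hr
      simp only [Ω, Fintype.sum_prod_type (α₁ := ι → Bool),
        Fintype.sum_prod_type (α₁ := ι)] at hsum hr ⊢
      linarith)
  refine h.trans_eq ?_
  simp only [Fintype.card_prod, Fintype.card_fun, Fintype.card_option, Fintype.card_bool,
    Fintype.card_fin]
  push_cast
  rw [Real.log_mul (by positivity) (by norm_num), Real.log_pow, Real.log_pow, Real.log_pow]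

/-! ### Distances and graph maps -/

section Metric

variable {V W : Type*} {G : SimpleGraph V} {H : SimpleGraph W}

theorem edist_hom_le (f : G →g H) (u v : V) : H.edist (f u) (f v) ≤ G.edist u v := by
  rcases eq_or_ne (G.edist u v) ⊤ with h | h
  · rw [h]; exact le_top
  · obtain ⟨p, hp⟩ := SimpleGraph.exists_walk_of_edist_ne_top h
    rw [← hp, ← SimpleGraph.Walk.length_map f p]
    exact SimpleGraph.edist_le _

theorem edist_iso (f : G ≃g H) (u v : V) : H.edist (f u) (f v) = G.edist u v :=
  (edist_hom_le f.toHom u v).antisymm (by simpa using edist_hom_le f.symm.toHom (f u) (f v))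

theorem ediam_iso (f : G ≃g H) : G.ediam = H.ediam := by
  rw [SimpleGraph.ediam_eq_iSup_iSup_edist, SimpleGraph.ediam_eq_iSup_iSup_edist]
  exact f.toEquiv.iSup_congr fun u =>
    (f.toEquiv.iSup_congr fun v => edist_iso f u v).symm

theorem diam_iso (f : G ≃g H) : G.diam = H.diam := by
  rw [SimpleGraph.diam, SimpleGraph.diam, ediam_iso f]

/-- A function that changes by at most one along edges bounds distances from below. -/
theorem le_add_edist (φ : V → ℕ) (hφ : ∀ u v, G.Adj u v → φ v ≤ φ u + 1) (u v : V) :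
    (φ v : ℕ∞) ≤ φ u + G.edist u v := by
  rcases eq_or_ne (G.edist u v) ⊤ with h | h
  · rw [h]; simp
  · obtain ⟨p, hp⟩ := SimpleGraph.exists_walk_of_edist_ne_top h
    rw [← hp]
    norm_cast
    clear hp h
    induction p with
    | nil => simp
    | cons ha p ih =>
      have := hφ _ _ ha
      rw [SimpleGraph.Walk.length_cons]
      omega

end Metric

/-! ### The hard networks -/

/-- The vertices of the hard networks. Each of the two sides has a leaf for each bit string of
length `L`, a vertex for each value of each bit, and a hub; there are `p` vertices for padding. -/
inductive Node (L p : ℕ) : Type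
  | leaf (s : Bool) (i : Fin L → Bool)
  | bit (s : Bool) (j : Fin L) (b : Bool)
  | hub (s : Bool)
  | pad (j : Fin p)

namespace Node

variable {L p n : ℕ}

/-- The vertices of the hard networks as a sum type. -/
def equivSum (L p : ℕ) :
    Node L p ≃ (Bool × (Fin L → Bool)) ⊕ (Bool × Fin L × Bool) ⊕ Bool ⊕ Fin p where
  toFun
    | leaf s i => .inl (s, i)
    | bit s j b => .inr (.inl (s, j, b))
    | hub s => .inr (.inr (.inl s))
    | pad j => .inr (.inr (.inr j))
  invFun
    | .inl (s, i) => leaf s i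
    | .inr (.inl (s, j, b)) => bit s j b
    | .inr (.inr (.inl s)) => hub s
    | .inr (.inr (.inr j)) => pad j
  left_inv u := by cases u <;> rfl
  right_inv u := by rcases u with _ | _ | _ | _ <;> rfl

instance : Fintype (Node L p) := Fintype.ofEquiv _ (equivSum L p).symm

theorem card_eq : Fintype.card (Node L p) = 2 * 2 ^ L + 4 * L + 2 + p := by
  rw [Fintype.card_congr (equivSum L p)]
  simp
  ring

/-- The player that owns a vertex. -/
def side : Node L p → Bool
  | leaf s _ => s
  | bit s _ _ => s
  | hub s => s
  | pad _ => false

/-- The other ends of the edges which a vertex contributes, padded by the vertex itself. -/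
def link (x y : (Fin L → Bool) → Bool) : Option (Option (Fin L)) → Node L p → Node L p
  | some (some j), leaf s i => bit s j (i j)
  | _, leaf s i => bif (bif s then y i else x i) then leaf s i else hub s
  | none, bit s _ _ => hub s
  | some _, bit s j b => bit (!s) j (!b)
  | _, hub s => hub (!s)
  | _, pad _ => hub false

/-- The hard network for given inputs of the two players. -/
def network (p : ℕ) (x y : (Fin L → Bool) → Bool) : SimpleGraph (Node L p) :=
  SimpleGraph.fromRel fun u v => ∃ k, link x y k u = v

variable {x y : (Fin L → Bool) → Bool}

theorem edist_link_le (k : Option (Option (Fin L))) (u : Node L p) :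
    (network p x y).edist u (link x y k u) ≤ 1 := by
  rw [SimpleGraph.edist_le_one_iff_adj_or_eq, or_iff_not_imp_right]
  exact fun h => (SimpleGraph.fromRel_adj _ _ _).2 ⟨h, .inl ⟨k, rfl⟩⟩

theorem ncard_edgeSet_network_le :
    (network p x y).edgeSet.ncard ≤ Fintype.card (Node L p) * (L + 2) := by
  have h : (network p x y).edgeSet ⊆
      (fun a : Node L p × Option (Option (Fin L)) => s(a.1, link x y a.2 a.1)) '' Set.univ := by
    intro e
    induction e using Sym2.ind with
    | _ u v =>
      rw [SimpleGraph.mem_edgeSet, network, SimpleGraph.fromRel_adj]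
      rintro ⟨-, ⟨k, rfl⟩ | ⟨k, rfl⟩⟩
      · exact ⟨(u, k), trivial, rfl⟩
      · exact ⟨(v, k), trivial, Sym2.eq_swap⟩
  calc _ ≤ _ := Set.ncard_le_ncard h (Set.toFinite _)
    _ ≤ _ := Set.ncard_image_le (Set.toFinite _)
    _ = _ := by simp [Set.ncard_univ]

/-- A bound for the distance of a vertex to the hub of its side. -/
def height (x y : (Fin L → Bool) → Bool) : Node L p → ℕ
  | leaf s i => bif (bif s then y i else x i) then 2 else 1
  | bit _ _ _ => 1
  | hub _ => 0
  | pad _ => 1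

theorem height_le_two (u : Node L p) : height x y u ≤ 2 := by
  rcases u with ⟨s, i⟩ | _ | _ | _ <;> simp [height]
  cases (bif s then y i else x i) <;> simp

theorem edist_hub_le (hL : 0 < L) (u : Node L p) :
    (network p x y).edist u (hub u.side) ≤ height x y u := by
  rcases u with ⟨s, i⟩ | ⟨s, j, b⟩ | s | j
  · cases h : (bif s then y i else x i)
    · simpa [link, h, height, side] using edist_link_le (x := x) (y := y) none (leaf s i : Node L p)
    -- Without a direct edge to the hub, the leaf goes through its bit vertex `0`, which exists
    -- since `0 < L`.
    · have h1 := edist_link_le (x := x) (y := y) (some (some ⟨0, hL⟩)) (leaf s i : Node L p)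
      have h2 := edist_link_le (x := x) (y := y) none
        (link x y (some (some ⟨0, hL⟩)) (leaf s i) : Node L p)
      have h3 := SimpleGraph.edist_triangle.trans (add_le_add h1 h2)
      simpa [link, h, height, side, one_add_one_eq_two] using h3
  · simpa [link, height, side] using edist_link_le (x := x) (y := y) none (bit s j b : Node L p)
  · simp [side]
  · simpa [link, height, side] using edist_link_le (x := x) (y := y) none (pad j : Node L p)

theorem edist_hub_hub_le (s t : Bool) :
    (network p x y).edist (hub s) (hub t) ≤ (bif s == t then 0 else 1 : ℕ) := by
  by_cases h : s = t
  · simp [h]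
  · obtain rfl : t = !s := by cases s <;> cases t <;> simp_all
    simpa [link] using edist_link_le (x := x) (y := y) none (hub s : Node L p)

theorem edist_le_height (hL : 0 < L) (u v : Node L p) :
    (network p x y).edist u v ≤
      (height x y u + (bif u.side == v.side then 0 else 1) + height x y v : ℕ) := by
  have h1 := edist_hub_le (x := x) (y := y) hL u
  have h2 := edist_hub_le (x := x) (y := y) hL v
  rw [SimpleGraph.edist_comm] at h2
  have h3 := SimpleGraph.edist_triangle.trans (add_le_add h1
    (edist_hub_hub_le (x := x) (y := y) u.side v.side))
  have h4 := SimpleGraph.edist_triangle.trans (add_le_add h3 h2)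
  exact_mod_cast h4

theorem ediam_network_le_five (hL : 0 < L) : (network p x y).ediam ≤ 5 := by
  refine SimpleGraph.ediam_le_of_edist_le fun u v => (edist_le_height hL u v).trans ?_
  have h1 := height_le_two (x := x) (y := y) u
  have h2 := height_le_two (x := x) (y := y) v
  have h3 : (bif u.side == v.side then 0 else 1 : ℕ) ≤ 1 := by
    cases u.side == v.side <;> simp
  exact_mod_cast (by omega :
    height x y u + (bif u.side == v.side then 0 else 1) + height x y v ≤ 5)

theorem edist_leaf_leaf_le (s : Bool) {i i' : Fin L → Bool} (h : i ≠ i') :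
    (network p x y).edist (leaf s i) (leaf (!s) i') ≤ 3 := by
  obtain ⟨j, hj⟩ := Function.ne_iff.1 h
  have hj' : i' j = !i j := by cases h1 : i j <;> cases h2 : i' j <;> simp_all
  have h1 := edist_link_le (x := x) (y := y) (some (some j)) (leaf s i : Node L p)
  have h2 := edist_link_le (x := x) (y := y) (some none) (bit s j (i j) : Node L p)
  have h3 := edist_link_le (x := x) (y := y) (some (some j)) (leaf (!s) i' : Node L p)
  simp only [link, hj'] at h1 h2 h3
  rw [SimpleGraph.edist_comm] at h3
  refine (SimpleGraph.edist_triangle.trans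
    (add_le_add (SimpleGraph.edist_triangle.trans (add_le_add h1 h2)) h3)).trans ?_
  norm_num

theorem height_eq_two {u : Node L p} (h : height x y u = 2) :
    ∃ s i, u = leaf s i ∧ (bif s then y i else x i) = true := by
  rcases u with ⟨s, i⟩ | _ | _ | _ <;> simp [height] at h
  refine ⟨s, i, rfl, ?_⟩
  cases h' : (bif s then y i else x i) <;> simp_all

/-- The route through the hubs exceeds 4 only for two leaves of height 2 on opposite sides;
disjointness makes their indices differ, and the shortcut through a differing bit applies. -/
theorem ediam_network_le_four (hL : 0 < L) (hxy : ¬∃ i, x i = true ∧ y i = true) :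
    (network p x y).ediam ≤ 4 := by
  refine SimpleGraph.ediam_le_of_edist_le fun u v => ?_
  have h1 := height_le_two (x := x) (y := y) u
  have h2 := height_le_two (x := x) (y := y) v
  by_cases h : height x y u = 2 ∧ height x y v = 2 ∧ u.side ≠ v.side
  · obtain ⟨hu, hv, hs⟩ := h
    obtain ⟨s, i, rfl, hi⟩ := height_eq_two hu
    obtain ⟨t, i', rfl, hi'⟩ := height_eq_two hv
    obtain rfl : t = !s := by cases s <;> cases t <;> simp_all [side]
    have hne : i ≠ i' := by
      rintro rfl
      exact hxy ⟨i, by cases s <;> simp_all⟩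
    exact (edist_leaf_leaf_le s hne).trans (by norm_num)
  · refine (edist_le_height hL u v).trans ?_
    have h3 : height x y u + (bif u.side == v.side then 0 else 1) + height x y v ≤ 4 := by
      by_cases hs : u.side = v.side
      · simp [hs]; omega
      · have : (bif u.side == v.side then 0 else 1 : ℕ) ≤ 1 := by
          cases u.side == v.side <;> simp
        have : ¬(height x y u = 2 ∧ height x y v = 2) := fun h' => h ⟨h'.1, h'.2, hs⟩
        omega
    exact_mod_cast h3

open Classical in
/-- The distance to `leaf false i` in the network of two inputs that meet in `i`. -/
noncomputable def distFrom (i : Fin L → Bool) : Node L p → ℕ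
  | leaf s i' => if i' = i then (bif s then 5 else 0) else bif s then 3 else 2
  | bit s j b => if b = i j then (bif s then 4 else 1) else bif s then 2 else 3
  | hub s => bif s then 3 else 2
  | pad _ => 2

/-- `distFrom i` is a 1-Lipschitz potential; `hx` and `hy` exclude the hub edges at the two leaves
`i`, the only ones that would break this. -/
theorem distFrom_link {i : Fin L → Bool} (hx : x i = true) (hy : y i = true)
    (k : Option (Option (Fin L))) (u : Node L p) :
    distFrom i (link x y k u) ≤ distFrom i u + 1 ∧
      distFrom i u ≤ distFrom i (link x y k u) + 1 := by
  rcases u with ⟨s, i'⟩ | ⟨s, j, b⟩ | s | j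
  · by_cases h : i' = i
    · subst h
      rcases k with _ | _ | j <;> cases s <;> simp [link, distFrom, hx, hy]
    · rcases k with _ | _ | j
      · cases s
        · cases hi : x i' <;> simp [link, distFrom, h, hi]
        · cases hi : y i' <;> simp [link, distFrom, h, hi]
      · cases s
        · cases hi : x i' <;> simp [link, distFrom, h, hi]
        · cases hi : y i' <;> simp [link, distFrom, h, hi]
      · by_cases hj : i' j = i j <;> cases s <;> simp [link, distFrom, h, hj]
  · rcases k with _ | k <;> cases s <;> cases b <;> cases h : i j <;> simp [link, distFrom, h]
  · rcases k with _ | _ | k <;> cases s <;> simp [link, distFrom]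
  · rcases k with _ | _ | k <;> simp [link, distFrom]

theorem five_le_edist {i : Fin L → Bool} (hx : x i = true) (hy : y i = true) :
    5 ≤ (network p x y).edist (leaf false i) (leaf true i) := by
  have h := le_add_edist (G := network p x y) (distFrom i) (fun u v huv => by
    obtain ⟨-, ⟨k, rfl⟩ | ⟨k, rfl⟩⟩ := (SimpleGraph.fromRel_adj _ _ _).1 huv
    · exact (distFrom_link hx hy k u).1
    · exact (distFrom_link hx hy k v).2) (leaf false i) (leaf true i)
  simpa [distFrom] using h

theorem five_le_diam_network_iff (hL : 0 < L) :
    5 ≤ (network p x y).diam ↔ ∃ i, x i = true ∧ y i = true := by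
  refine ⟨fun h => ?_, ?_⟩
  · by_contra hxy
    have := ENat.toNat_le_of_le_natCast (n := 4) (ediam_network_le_four (p := p) hL hxy)
    rw [← SimpleGraph.diam] at this
    omega
  · rintro ⟨i, hx, hy⟩
    -- Finiteness is needed because `diam` sends an infinite `ediam` to `0`.
    have h5 := ediam_network_le_five (p := p) (x := x) (y := y) hL
    have := ENat.toNat_le_toNat ((five_le_edist (p := p) hx hy).trans SimpleGraph.edist_le_ediam)
      (ne_top_of_le_ne_top (by decide) h5)
    simpa [SimpleGraph.diam] using this

theorem diam_network_le_five (hL : 0 < L) : (network p x y).diam ≤ 5 :=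
  ENat.toNat_le_of_le_natCast (ediam_network_le_five hL)

theorem connected_network (hL : 0 < L) : (network p x y).Connected := by
  have : Nonempty (Node L p) := ⟨hub false⟩
  exact SimpleGraph.connected_of_ediam_ne_top
    (ne_top_of_le_ne_top (by decide) (ediam_network_le_five hL))

/-! ### The two-party family of hard networks -/

theorem link_congr_left (x y y' : (Fin L → Bool) → Bool) (k : Option (Option (Fin L)))
    {u : Node L p} (hu : u.side = false) : link x y k u = link x y' k u := by
  rcases u with ⟨s, i⟩ | ⟨s, j, b⟩ | s | j <;> rcases k with _ | _ | k <;> simp_all [side, link]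

theorem link_congr_right (x x' y : (Fin L → Bool) → Bool) (k : Option (Option (Fin L)))
    {u : Node L p} (hu : u.side = true) : link x y k u = link x' y k u := by
  rcases u with ⟨s, i⟩ | ⟨s, j, b⟩ | s | j <;> rcases k with _ | _ | k <;> simp_all [side, link]

/-- Inputs only affect links inside a side. This handles an edge at one player's vertex that is
contributed by the other player's endpoint. -/
theorem link_congr_of_side_ne (x y x' y' : (Fin L → Bool) → Bool) (k : Option (Option (Fin L)))
    {u : Node L p} (hu : (link x y k u).side ≠ u.side) : link x y k u = link x' y' k u := by
  rcases u with ⟨s, i⟩ | ⟨s, j, b⟩ | s | j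
  · refine absurd ?_ hu
    rcases k with _ | _ | k
    · cases h : (bif s then y i else x i) <;> simp [link, side, h]
    · cases h : (bif s then y i else x i) <;> simp [link, side, h]
    · simp [link, side]
  all_goals rcases k with _ | _ | k <;> simp [link]

theorem adj_network_left (x y y' : (Fin L → Bool) → Bool) {u v : Node L p}
    (hu : u.side = false) : (network p x y).Adj u v → (network p x y').Adj u v := by
  simp only [network, SimpleGraph.fromRel_adj]
  rintro ⟨hne, ⟨k, rfl⟩ | ⟨k, rfl⟩⟩
  · exact ⟨hne, .inl ⟨k, link_congr_left x y' y k hu⟩⟩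
  · refine ⟨hne, .inr ⟨k, ?_⟩⟩
    cases hv : v.side
    · exact link_congr_left x y' y k hv
    · exact (link_congr_of_side_ne x y x y' k (by simp [hu, hv])).symm

theorem adj_network_right (x x' y : (Fin L → Bool) → Bool) {u v : Node L p}
    (hu : u.side = true) : (network p x y).Adj u v → (network p x' y).Adj u v := by
  simp only [network, SimpleGraph.fromRel_adj]
  rintro ⟨hne, ⟨k, rfl⟩ | ⟨k, rfl⟩⟩
  · exact ⟨hne, .inl ⟨k, link_congr_right x' x y k hu⟩⟩
  · refine ⟨hne, .inr ⟨k, ?_⟩⟩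
    cases hv : v.side
    · exact (link_congr_of_side_ne x y x' y k (by simp [hu, hv])).symm
    · exact link_congr_right x' x y k hv

/-- The directed edges between the two sides. -/
def crossing : Bool × Option (Fin L × Bool) → Node L p × Node L p
  | (s, none) => (hub s, hub (!s))
  | (s, some (j, b)) => (bit s j b, bit (!s) j (!b))

theorem exists_crossing_link {k : Option (Option (Fin L))} {u : Node L p}
    (hu : (link x y k u).side ≠ u.side) :
    (∃ c, crossing c = (u, link x y k u)) ∧ ∃ c, crossing c = (link x y k u, u) := by
  rcases u with ⟨s, i⟩ | ⟨s, j, b⟩ | s | j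
  · refine absurd ?_ hu
    rcases k with _ | _ | k
    · cases h : (bif s then y i else x i) <;> simp [link, side, h]
    · cases h : (bif s then y i else x i) <;> simp [link, side, h]
    · simp [link, side]
  · rcases k with _ | k
    · simp [link, side] at hu
    · exact ⟨⟨(s, some (j, b)), by simp [crossing, link]⟩,
        ⟨(!s, some (j, !b)), by simp [crossing, link]⟩⟩
  · refine ⟨⟨(s, none), ?_⟩, ⟨(!s, none), ?_⟩⟩ <;>
      rcases k with _ | _ | k <;> simp [crossing, link]
  · rcases k with _ | _ | k <;> simp [link, side] at hu

theorem exists_crossing {u v : Node L p} (h : (network p x y).Adj u v) (hs : u.side ≠ v.side) :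
    ∃ c, crossing c = (u, v) := by
  obtain ⟨-, ⟨k, rfl⟩ | ⟨k, rfl⟩⟩ := (SimpleGraph.fromRel_adj _ _ _).1 h
  · exact (exists_crossing_link hs.symm).1
  · exact (exists_crossing_link hs).2

/-- The hard networks, with the vertices numbered by `e`. -/
def family (e : Fin n ≃ Node L p) : TwoPartyFamily n ((Fin L → Bool) → Bool)
    ((Fin L → Bool) → Bool) (Bool × Option (Fin L × Bool)) where
  graph x y := (network p x y).comap e
  left := {v | (e v).side = false}
  cut c := (e.symm (crossing c).1, e.symm (crossing c).2)
  adj_left x y y' _ _ hu := ⟨adj_network_left x y y' hu, adj_network_left x y' y hu⟩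
  adj_right x x' y _ _ hu := by
    have hu := Bool.eq_true_of_not_eq_false hu
    exact ⟨adj_network_right x x' y hu, adj_network_right x' x y hu⟩
  exists_cut x y u v h hs := by
    obtain ⟨c, hc⟩ := exists_crossing h (by
      intro h'
      simp only [Set.mem_ofPred_eq, h'] at hs
      tauto)
    exact ⟨c, by simp [hc]⟩

/-- The numbering of the vertices is an isomorphism. -/
def familyIso (e : Fin n ≃ Node L p) (x y : (Fin L → Bool) → Bool) :
    (family e).graph x y ≃g network p x y :=
  SimpleGraph.Iso.comap e _

theorem family_mem_sparseNetworks (hL : 0 < L) (e : Fin n ≃ Node L p) {C : ℝ}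
    (hC : (L + 2 : ℝ) ≤ C * Real.log n) (x y : (Fin L → Bool) → Bool) :
    (family e).graph x y ∈ sparseNetworks n C 5 := by
  refine ⟨(familyIso e x y).connected_iff.2 (connected_network hL), ?_,
    (diam_iso (familyIso e x y)).trans_le (diam_network_le_five hL)⟩
  have h1 : ((family e).graph x y).edgeSet.ncard = (network p x y).edgeSet.ncard :=
    Nat.card_congr (familyIso e x y).mapEdgeSet
  have h2 : Fintype.card (Node L p) = n := by
    rw [← Fintype.card_congr e, Fintype.card_fin]
  have h3 := ncard_edgeSet_network_le (p := p) (x := x) (y := y)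
  rw [h2, ← h1] at h3
  calc _ ≤ ((n * (L + 2) : ℕ) : ℝ) := by exact_mod_cast h3
    _ = n * (L + 2 : ℝ) := by push_cast; ring
    _ ≤ n * (C * Real.log n) := by gcongr
    _ = _ := by ring

theorem five_le_diam_family_iff (hL : 0 < L) (e : Fin n ≃ Node L p)
    (x y : (Fin L → Bool) → Bool) :
    5 ≤ ((family e).graph x y).diam ↔ ∃ i, x i = true ∧ y i = true := by
  rw [diam_iso (familyIso e x y), five_le_diam_network_iff hL]

end Node

/-- The hard networks fit into `n` vertices with a number of leaves linear in `n`. -/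
theorem exists_equiv_node {n : ℕ} (hn : 16 ≤ n) :
    ∃ L p : ℕ, 0 < L ∧ 2 ^ (L + 3) ≤ n ∧ n < 2 ^ (L + 4) ∧ Nonempty (Fin n ≃ Node L p) := by
  have h4 : 4 ≤ Nat.log 2 n := Nat.le_log_of_pow_le (by norm_num) hn
  obtain ⟨L, hL⟩ : ∃ L, Nat.log 2 n = L + 3 := ⟨Nat.log 2 n - 3, by omega⟩
  have h1 : 2 ^ (L + 3) ≤ n := hL ▸ Nat.pow_log_le_self 2 (by omega)
  have h2 : n < 2 ^ (L + 4) := by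
    have := Nat.lt_pow_succ_log_self (b := 2) (by norm_num) n
    rwa [hL] at this
  -- This gives `2 * 2 ^ L + 4 * L + 2 ≤ 8 * 2 ^ L ≤ n`, so the subtraction defining the padding
  -- does not truncate.
  have h3 : L < 2 ^ L := Nat.lt_two_pow_self
  have h5 : 2 ^ (L + 3) = 8 * 2 ^ L := by ring
  refine ⟨L, n - (2 * 2 ^ L + 4 * L + 2), by omega, h1, h2, ⟨Fintype.equivOfCardEq ?_⟩⟩
  rw [Fintype.card_fin, Node.card_eq]
  omega

/-- Any parameter from which one can read off whether the diameter is at least `5` is hard. -/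
theorem rounds_lower_bound {β : ℝ} (hβ : 0 < β) {n : ℕ} (hn : 18432 ≤ n) {B : ℕ}
    (hB : (B : ℝ) ≤ β * Real.log n) {T : ℕ} {α : Type} (f : SimpleGraph (Fin n) → α) (q : α → Prop)
    (hq : ∀ G, q (f G) ↔ 5 ≤ G.diam) (A : RandomizedAlgorithm n B α)
    (hA : A.Computes T (sparseNetworks n 2 5) f) :
    1 / (294912 * β) * (n / Real.log n ^ 2) ≤ T := by
  obtain ⟨L, p, hL, h1, h2, ⟨e⟩⟩ := exists_equiv_node (by omega : 16 ≤ n)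
  have hn' : (18432 : ℝ) ≤ n := by exact_mod_cast hn
  have hlog : (L + 3 : ℝ) ≤ 2 * Real.log n := by
    have h3 : ((2 : ℝ) ^ (L + 3)) ≤ n := by exact_mod_cast h1
    have h4 := Real.log_le_log (by positivity) h3
    rw [Real.log_pow] at h4
    push_cast at h4
    have := Real.log_two_gt_d9
    nlinarith [(Nat.cast_nonneg L : (0 : ℝ) ≤ L)]
  have hL0 : (0 : ℝ) ≤ L := Nat.cast_nonneg L
  have hlog0 : 0 < Real.log n := by linarith
  have h := (Node.family e).card_le_of_computes A hA
    (Node.family_mem_sparseNetworks hL e (by linarith)) q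
    (fun x y => (hq _).trans (Node.five_le_diam_family_iff hL e x y))
    (v₀ := e.symm (.hub false)) (by simp [Node.family, Node.side])
  simp only [Fintype.card_fun, Fintype.card_prod, Fintype.card_option, Fintype.card_bool,
    Fintype.card_fin] at h
  push_cast at h
  have h5 : (n : ℝ) ≤ 16 * 2 ^ L := by
    have : (n : ℝ) < 2 ^ (L + 4) := by exact_mod_cast h2
    linarith [pow_add (2 : ℝ) L 4]
  have hl3 : Real.log 3 ≤ 2 := (Real.log_le_sub_one_of_pos (by norm_num)).trans (by norm_num)
  have hl2 : Real.log 2 ≤ 1 := (Real.log_le_sub_one_of_pos (by norm_num)).trans (by norm_num)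
  have h6 : (T : ℝ) * (2 * (L * 2 + 1) * (B * Real.log 3)) ≤
      T * (8 * Real.log n * (β * Real.log n * 2)) := by
    have := Real.log_nonneg (by norm_num : (1 : ℝ) ≤ 3)
    have h7 : 2 * (L * 2 + 1) ≤ 8 * Real.log n := by linarith
    exact mul_le_mul_of_nonneg_left
      (mul_le_mul h7 (by gcongr) (by positivity) (by positivity)) (Nat.cast_nonneg T)
  -- Altogether `n ≤ 16 * 576 * (16 * β * T * log n ^ 2 + 1)`. The additive `9216` is at most `n /
  -- 2` by `hn`, and doubling the rest gives `294912`.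
  rw [one_div_mul_eq_div, div_div, div_le_iff₀ (by positivity)]
  nlinarith

end Congest

theorem mainTheorem1 :
    ∃ (C : ℝ) (Δ : ℕ), ∀ β : ℝ, 0 < β → ∃ c : ℝ, 0 < c ∧ ∃ N : ℕ, ∀ n : ℕ, N ≤ n →
      ∀ B : ℕ, (B : ℝ) ≤ β * Real.log n → ∀ T : ℕ,
        (∀ A : Congest.RandomizedAlgorithm n B ℕ,
          A.Computes T (Congest.sparseNetworks n C Δ) (fun G => G.diam) →
            c * (n / Real.log n ^ 2) ≤ T) ∧
        (∀ A : Congest.RandomizedAlgorithm n B Bool,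
          A.Computes T (Congest.sparseNetworks n C Δ) (fun G => decide (5 ≤ G.diam)) →
            c * (n / Real.log n ^ 2) ≤ T) := by
  refine ⟨2, 5, fun β hβ => ⟨1 / (294912 * β), by positivity, 18432, fun n hn B hB T => ⟨?_, ?_⟩⟩⟩
  · exact Congest.rounds_lower_bound hβ hn hB _ (5 ≤ ·) fun G => Iff.rfl
  · exact Congest.rounds_lower_bound hβ hn hB _ (· = true) fun G => by simp
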